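/- Let $\mathbb N=\{1,2,3,\dots\}$ and let $\mathbb H=\{z\in\mathbb C:\operatorname{Re} z\ge 0\}$ be the closed right half plane. A function $f:\mathbb H^2\to\mathbb C$ is said to have an absolutely convergent Dirichlet series with coefficients $a:\mathbb N^2\to\mathbb C$ if $\sum_{(m,n)\in\mathbb N^2}|a(m,n)|<\infty$ and $$f(s_1,s_2)=\sum_{(m,n)\in\mathbb N^2}a(m,n)\,m^{-s_1}n^{-s_2}\qquad\text{for all }(s_1,s_2)\in\mathbb H^2 .$$ Let $\ell^1(\mathbb N^2)$ be the space of all $a:\mathbb N^2\to\mathbb C$ with $\sum_{(m,n)}|a(m,n)|<\infty$, with the Dirichlet convolution $$(a\star b)(m,n)=\sum_{u_1u_2=m,\;v_1v_2=n}a(u_1,v_1)\,b(u_2,v_2),$$ whose unit is $\delta_{(1,1)}$, the function equal to $1$ at $(1,1)$ and $0$ elsewhere. **Theorem A.** Let $\widetilde a:\mathbb H^2\to\mathbb C$ have an absolutely convergent Dirichlet series with coefficients $a=(a(m,n))$. Then the following statements are equivalent. 1. $\widetilde a$ has no zero in $\mathbb H^2$, and $1/\widetilde a:\mathbb H^2\to\mathbb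 C$ has an absolutely convergent Dirichlet series (with some coefficients $b:\mathbb N^2\to\mathbb C$). 2. $a$ has an inverse in $\ell^1(\mathbb N^2)$, i.e. there is $b\in\ell^1(\mathbb N^2)$ with $a\star b=b\star a=\delta_{(1,1)}$. 3. $\widetilde a$ is bounded away from zero on $\mathbb H^2$, i.e. there is $c>0$ with $|\widetilde a(s_1,s_2)|\ge c$ for all $(s_1,s_2)\in\mathbb H^2$. -/

import Mathlib

namespace DirichletTwo

/-- The closed right half plane `ℍ = {z ∈ ℂ : Re z ≥ 0}`. -/
abbrev HalfPlane : Type := {z : ℂ // 0 ≤ z.re}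

/-- `a : ℕ² → ℂ` (with `ℕ = {1, 2, …}`) is absolutely summable, i.e. `a ∈ ℓ¹(ℕ²)`. -/
def MemEllOne (a : ℕ+ × ℕ+ → ℂ) : Prop :=
  Summable fun k => ‖a k‖

/-- `f : ℍ² → ℂ` is the sum on `ℍ²` of the absolutely convergent Dirichlet series
`∑ a(m,n) m^{-s₁} n^{-s₂}`. -/
def IsAbsDirichletSeries (f : HalfPlane × HalfPlane → ℂ) (a : ℕ+ × ℕ+ → ℂ) : Prop :=
  MemEllOne a ∧
    ∀ s : HalfPlane × HalfPlane,
      HasSum (fun k : ℕ+ × ℕ+ => a k * (k.1 : ℂ) ^ (-(s.1 : ℂ)) * (k.2 : ℂ) ^ (-(s.2 : ℂ))) (f s)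

/-- `f : ℍ² → ℂ` has an absolutely convergent Dirichlet series. -/
def HasAbsDirichletSeries (f : HalfPlane × HalfPlane → ℂ) : Prop :=
  ∃ a : ℕ+ × ℕ+ → ℂ, IsAbsDirichletSeries f a

/-- The pairs `((u₁,v₁), (u₂,v₂))` with `u₁ u₂ = m` and `v₁ v₂ = n`, where `k = (m,n)`. -/
def factorPairs (k : ℕ+ × ℕ+) : Set ((ℕ+ × ℕ+) × (ℕ+ × ℕ+)) :=
  {p | p.1 * p.2 = k}

theorem factorPairs_finite (k : ℕ+ × ℕ+) : (factorPairs k).Finite := by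
  refine ((Set.finite_Iic k).prod (Set.finite_Iic k)).subset ?_
  rintro ⟨⟨u, v⟩, ⟨u', v'⟩⟩ rfl
  refine ⟨⟨?_, ?_⟩, ⟨?_, ?_⟩⟩
  · exact PNat.le_of_dvd (Dvd.intro u' rfl)
  · exact PNat.le_of_dvd (Dvd.intro v' rfl)
  · exact PNat.le_of_dvd (Dvd.intro_left u rfl)
  · exact PNat.le_of_dvd (Dvd.intro_left v rfl)

/-- Dirichlet convolution
`(a ⋆ b)(m,n) = ∑_{u₁u₂ = m, v₁v₂ = n} a(u₁,v₁) b(u₂,v₂)`, a finite sum. -/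
noncomputable def conv (a b : ℕ+ × ℕ+ → ℂ) (k : ℕ+ × ℕ+) : ℂ :=
  ∑ p ∈ (factorPairs_finite k).toFinset, a p.1 * b p.2

/-- The unit `δ_{(1,1)}` of Dirichlet convolution. -/
noncomputable def convOne : ℕ+ × ℕ+ → ℂ :=
  Pi.single 1 1

/-- `a` has an inverse in `ℓ¹(ℕ²)` under Dirichlet convolution. -/
def HasInverseInEllOne (a : ℕ+ × ℕ+ → ℂ) : Prop :=
  MemEllOne a ∧ ∃ b : ℕ+ × ℕ+ → ℂ, MemEllOne b ∧ conv a b = convOne ∧ conv b a = convOne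

/-- `f` is bounded away from zero on `ℍ²`. -/
def BoundedAwayFromZero (f : HalfPlane × HalfPlane → ℂ) : Prop :=
  ∃ c : ℝ, 0 < c ∧ ∀ s, c ≤ ‖f s‖

/-- The reciprocal `1/f` is defined on all of `ℍ²` (so `f` has no zero there) and has an absolutely
convergent Dirichlet series. -/
def ReciprocalHasAbsDirichletSeries (f : HalfPlane × HalfPlane → ℂ) : Prop :=
  (∀ s, f s ≠ 0) ∧ HasAbsDirichletSeries fun s => 1 / f s

end DirichletTwo

/-! A summable reciprocal series is bounded, and evaluation at a point of `ℍ²` is multiplicative on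
`ℓ¹`, so the hard implication is 3 → 2. Under Dirichlet convolution `ℓ¹(ℕ²)` is a commutative Banach
algebra, so by Gelfand theory a non-invertible `a` is killed by a bounded character `χ` of the
monoid `ℕ²` (`exists_character_of_not_hasInverseInEllOne`). Such a `χ` need not come from a point of
`ℍ²`: its values at primes are arbitrary points of the closed disc, possibly 0.

After truncation to finitely many terms, `a` becomes a polynomial `P` in finitely many variables
`p^(-s₁)`, `p^(-s₂)`. Since the `log p` are independent over the integers, Kronecker's theorem
carries the lower bound for `P` to every torus `|z_p| = ρ^(log p)` with `0 < ρ ≤ 1`. Growing `ρ`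
from 0 and applying the maximum principle to `1/P` spreads it over the closed polydisc
(`le_norm_of_forall_mem_torus_le_norm`), hence to the point given by `χ`, a contradiction. -/

open MeasureTheory

/-! ### Means along a linear flow and Kronecker's theorem -/

/-- The constant term of a trigonometric sum is bounded by any bound for the sum. -/
theorem norm_constantTerm_le {ι : Type*} (S : Finset ι) (freq : ι → ℝ) (hS : ∀ i ∈ S, freq i ≠ 0)
    (a : ℂ) (b : ι → ℂ) (C : ℝ)
    (hC : ∀ t : ℝ, ‖a + ∑ i ∈ S, b i * Complex.exp (freq i * t * Complex.I)‖ ≤ C) : ‖a‖ ≤ C := by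
  classical
  induction S using Finset.induction_on generalizing b with
  | empty => simpa using hC 0
  | insert j S hj ih =>
    -- A half-period of the `j`-th term: averaging the sum at `t` and `t + τ` cancels that term,
    -- fixes `a`, only rescales the other coefficients, and keeps the bound `C`.
    set τ : ℝ := Real.pi / freq j with hτ
    have hfj : (freq j : ℂ) ≠ 0 := by exact_mod_cast hS j (by simp)
    refine ih (fun i hi => hS i (Finset.mem_insert_of_mem hi))
      (fun i => b i * ((1 + Complex.exp (freq i * τ * Complex.I)) / 2)) fun t => ?_
    have hshift : ∀ i, Complex.exp (freq i * ((t + τ : ℝ) : ℂ) * Complex.I) =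
        Complex.exp (freq i * t * Complex.I) * Complex.exp (freq i * τ * Complex.I) := fun i => by
      rw [← Complex.exp_add]
      push_cast
      ring_nf
    have hjτ : Complex.exp (freq j * τ * Complex.I) = -1 := by
      rw [hτ, Complex.ofReal_div, mul_div_cancel₀ _ hfj, Complex.exp_pi_mul_I]
    have key : a + ∑ i ∈ S, b i * ((1 + Complex.exp (freq i * τ * Complex.I)) / 2) *
          Complex.exp (freq i * t * Complex.I) =
        ((a + ∑ i ∈ insert j S, b i * Complex.exp (freq i * t * Complex.I)) +
          (a + ∑ i ∈ insert j S, b i * Complex.exp (freq i * ((t + τ : ℝ) : ℂ) * Complex.I))) / 2 := by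
      simp only [hshift, Finset.sum_insert hj, hjτ]
      have : ∑ i ∈ S, b i * ((1 + Complex.exp (freq i * τ * Complex.I)) / 2) *
          Complex.exp (freq i * t * Complex.I) =
          (∑ i ∈ S, b i * Complex.exp (freq i * t * Complex.I) +
          ∑ i ∈ S, b i * (Complex.exp (freq i * t * Complex.I) *
            Complex.exp (freq i * τ * Complex.I))) / 2 := by
        rw [← Finset.sum_add_distrib, Finset.sum_div]
        exact Finset.sum_congr rfl fun i _ => by ring
      rw [this]
      ring
    rw [key, norm_div, Complex.norm_two]
    have := norm_add_le (a + ∑ i ∈ insert j S, b i * Complex.exp (freq i * t * Complex.I))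
      (a + ∑ i ∈ insert j S, b i * Complex.exp (freq i * ((t + τ : ℝ) : ℂ) * Complex.I))
    have h1 := hC t
    have h2 := hC (t + τ)
    linarith

namespace UnitAddTorus

variable {d : Type*} [Fintype d]

/-- The Haar probability measure on the torus. -/
noncomputable abbrev haarTorus (d : Type*) [Fintype d] : Measure (UnitAddTorus d) :=
  Measure.pi fun _ => AddCircle.haarAddCircle

theorem integral_mFourier_of_ne_zero {n : d → ℤ} (hn : n ≠ 0) :
    ∫ x, mFourier n x ∂haarTorus d = 0 := by
  obtain ⟨i, hi⟩ := Function.ne_iff.mp hn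
  simp only [mFourier, ContinuousMap.coe_mk]
  rw [integral_fintype_prod_eq_prod]
  exact Finset.prod_eq_zero (Finset.mem_univ i)
    -- In a coordinate with `n i ≠ 0`, translation by a half-period of the character changes its
    -- sign.
    (integral_eq_zero_of_add_right_eq_neg (fourier_add_half_inv_index hi one_pos))

/-- The linear flow on the torus with direction `ω`. -/
def linearFlow (ω : d → ℝ) (t : ℝ) : UnitAddTorus d := fun i => ((t * ω i : ℝ) : UnitAddCircle)

theorem mFourier_linearFlow (ω : d → ℝ) (n : d → ℤ) (t : ℝ) :
    mFourier n (linearFlow ω t) =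
      Complex.exp ((2 * Real.pi * ∑ i, n i * ω i : ℝ) * t * Complex.I) := by
  simp only [mFourier, ContinuousMap.coe_mk, linearFlow, fourier_coe_apply]
  rw [← Complex.exp_sum]
  congr 1
  push_cast
  rw [Finset.mul_sum, Finset.sum_mul, Finset.sum_mul]
  exact Finset.sum_congr rfl fun i _ => by ring

/-- A continuous function on the torus has its mean bounded by its supremum along a linear flow
with rationally independent frequencies. -/
theorem norm_integral_le_of_linearFlow {ω : d → ℝ}
    (hω : ∀ n : d → ℤ, ∑ i, n i * ω i = 0 → n = 0) (h : C(UnitAddTorus d, ℂ)) (C : ℝ)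
    (hC : ∀ t, ‖h (linearFlow ω t)‖ ≤ C) : ‖∫ x, h x ∂haarTorus d‖ ≤ C := by
  classical
  have hint : ∀ g : C(UnitAddTorus d, ℂ), Integrable g (haarTorus d) := fun g =>
    g.continuous.integrable_of_hasCompactSupport (HasCompactSupport.of_compactSpace _)
  have htrig : ∀ g ∈ Submodule.span ℂ (Set.range (mFourier (d := d))), ∀ C : ℝ,
      (∀ t, ‖g (linearFlow ω t)‖ ≤ C) → ‖∫ x, g x ∂haarTorus d‖ ≤ C := by
    intro g hg C hgC
    obtain ⟨c, rfl⟩ := (Finsupp.mem_span_range_iff_exists_finsupp).1 hg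
    have hsplit : c.sum (fun i a => a • mFourier i) =
        c 0 • (1 : C(UnitAddTorus d, ℂ)) + ∑ i ∈ c.support.erase 0, c i • mFourier i := by
      rw [← mFourier_zero]
      by_cases h0 : (0 : d → ℤ) ∈ c.support
      · exact (Finset.add_sum_erase _ _ h0).symm
      · rw [Finset.erase_eq_of_notMem h0, Finsupp.notMem_support_iff.1 h0]
        ext x
        simp [Finsupp.sum]
    have hmean : ∫ x, (c.sum fun i a => a • mFourier i) x ∂haarTorus d = c 0 := by
      rw [hsplit]
      simp only [ContinuousMap.add_apply, ContinuousMap.sum_apply, ContinuousMap.smul_apply,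
        ContinuousMap.one_apply]
      have hsmul : ∀ i ∈ c.support.erase 0,
          Integrable (fun x => c i • mFourier i x) (haarTorus d) :=
        fun i _ => (hint (mFourier i)).smul (c i)
      rw [integral_add (integrable_const _) (integrable_finsetSum _ hsmul),
        integral_finsetSum _ hsmul, Finset.sum_eq_zero fun i hi => ?_]
      · simp
      · rw [integral_smul, integral_mFourier_of_ne_zero (Finset.ne_of_mem_erase hi), smul_zero]
    rw [hmean]
    -- Along the flow `g` is a trigonometric sum with constant term its mean `c 0`; independence of
    -- `ω` makes all other frequencies nonzero.
    refine norm_constantTerm_le (c.support.erase 0)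
      (fun n => 2 * Real.pi * ∑ i, n i * ω i) (fun n hn h0 => ?_) (c 0) c C fun t => ?_
    · refine Finset.ne_of_mem_erase hn (hω n ?_)
      simpa [Real.pi_ne_zero] using h0
    · have := hgC t
      rw [hsplit] at this
      simpa only [ContinuousMap.add_apply, ContinuousMap.sum_apply, ContinuousMap.smul_apply,
        ContinuousMap.one_apply, mFourier_linearFlow, smul_eq_mul, mul_one] using this
  refine le_of_forall_pos_le_add fun ε hε => ?_
  have hdense : h ∈ closure (Submodule.span ℂ (Set.range (mFourier (d := d))) : Set _) := by
    rw [← Submodule.topologicalClosure_coe, span_mFourier_closure_eq_top]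
    trivial
  -- One `ε / 2` pays for the bound along the flow, the other for the change of the integral.
  obtain ⟨g, hg, hgh⟩ := Metric.mem_closure_iff.1 hdense (ε / 2) (half_pos hε)
  have hpt : ∀ x, ‖h x - g x‖ ≤ ε / 2 := fun x => by
    rw [← dist_eq_norm]
    exact (ContinuousMap.dist_apply_le_dist x).trans hgh.le
  have hgint := htrig g hg (C + ε / 2) fun t => by
    have h1 := norm_sub_norm_le (g (linearFlow ω t)) (h (linearFlow ω t))
    rw [norm_sub_rev] at h1
    linarith [hC t, hpt (linearFlow ω t)]
  have hdiff : ‖∫ x, (h x - g x) ∂haarTorus d‖ ≤ ε / 2 := by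
    simpa using norm_integral_le_of_norm_le_const (μ := haarTorus d)
      (Filter.Eventually.of_forall hpt)
  rw [integral_sub (hint h) (hint g)] at hdiff
  linarith [norm_sub_norm_le (∫ x, h x ∂haarTorus d) (∫ x, g x ∂haarTorus d)]

/-- **Kronecker's theorem**: a linear flow with rationally independent frequencies is dense. -/
theorem denseRange_linearFlow {ω : d → ℝ} (hω : ∀ n : d → ℤ, ∑ i, n i * ω i = 0 → n = 0) :
    DenseRange (linearFlow ω) := by
  intro x
  have hne : (Set.range (linearFlow ω)).Nonempty := Set.range_nonempty _
  rw [Metric.mem_closure_iff_infDist_zero hne]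
  by_contra hx
  have hcont : Continuous fun y => Metric.infDist y (Set.range (linearFlow ω)) :=
    Metric.continuous_infDist_pt _
  -- The distance to the orbit vanishes along the flow, so its mean must be 0; a point off the
  -- closure would make that mean positive.
  have hpos : 0 < ∫ y, Metric.infDist y (Set.range (linearFlow ω)) ∂haarTorus d :=
    hcont.integral_pos_of_hasCompactSupport_nonneg_nonzero
      (HasCompactSupport.of_compactSpace _) (fun _ => Metric.infDist_nonneg) hx
  have hle := norm_integral_le_of_linearFlow hω
    ⟨fun y => (Metric.infDist y (Set.range (linearFlow ω)) : ℂ),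
      Complex.continuous_ofReal.comp hcont⟩ 0 fun t => by
    simp [Metric.infDist_zero_of_mem (Set.mem_range_self t)]
  simp only [ContinuousMap.coe_mk] at hle
  rw [integral_complex_ofReal, Complex.norm_real, Real.norm_of_nonneg hpos.le] at hle
  linarith

end UnitAddTorus

/-! ### Independence of the logarithms of primes -/

/-- The logarithms of distinct primes are linearly independent over the integers. -/
theorem eq_zero_of_sum_int_mul_log_prime_eq_zero (T : Finset Nat.Primes) (n : T → ℤ)
    (h : ∑ p : T, n p * Real.log ((p : Nat.Primes) : ℕ) = 0) : n = 0 := by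
  have hpos : ∀ p : T, ((((p : Nat.Primes) : ℕ) : ℚ)) ≠ 0 := fun p => by
    exact_mod_cast p.1.2.ne_zero
  have hprod : ∏ p : T, (((p : Nat.Primes) : ℕ) : ℚ) ^ n p = 1 := by
    have hR : ∏ p : T, (((p : Nat.Primes) : ℕ) : ℝ) ^ n p = 1 := by
      have h0 : ∀ p : T, (0 : ℝ) < (((p : Nat.Primes) : ℕ) : ℝ) := fun p => by
        exact_mod_cast p.1.2.pos
      refine Real.eq_one_of_pos_of_log_eq_zero (Finset.prod_pos fun p _ => zpow_pos (h0 p) _) ?_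
      rw [Real.log_prod fun p _ => (zpow_pos (h0 p) _).ne']
      simpa only [Real.log_zpow] using h
    refine Rat.cast_injective (α := ℝ) ?_
    push_cast
    exact hR
  funext q
  have : Fact (q : Nat.Primes).1.Prime := ⟨q.1.2⟩
  -- The `q`-adic valuation of the product isolates the exponent `n q`.
  have hval := congrArg (padicValRat (q : Nat.Primes).1) hprod
  have hsum : ∀ s : Finset T, padicValRat (q : Nat.Primes).1
      (∏ p ∈ s, (((p : Nat.Primes) : ℕ) : ℚ) ^ n p) = ∑ p ∈ s, if p = q then n p else 0 := by
    classical
    intro s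
    induction s using Finset.induction_on with
    | empty => simp
    | insert p s hp ih =>
      rw [Finset.prod_insert hp, Finset.sum_insert hp, padicValRat.mul (zpow_ne_zero _ (hpos p))
        (Finset.prod_ne_zero_iff.2 fun p _ => zpow_ne_zero _ (hpos p)), ih,
        padicValRat.zpow, padicValRat.of_nat]
      congr 1
      split_ifs with hpq
      · subst hpq
        simp [padicValNat_self]
      · have hne : (p : Nat.Primes).1 ≠ (q : Nat.Primes).1 := fun h' =>
          hpq (Subtype.ext (Subtype.ext h'))
        have : Fact (p : Nat.Primes).1.Prime := ⟨p.1.2⟩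
        rw [padicValNat_primes hne.symm]
        simp
  rw [hsum] at hval
  simpa using hval

/-! ### Bounds on polydiscs -/

/-- Maximum modulus principle on a polydisc: a continuous separately holomorphic function is bounded
by its bound on the distinguished boundary. -/
theorem norm_le_of_forall_mem_torus_norm_le {ι : Type*} [Fintype ι] [DecidableEq ι] {G : (ι → ℂ) → ℂ}
    {r : ι → ℝ} (hr : ∀ i, 0 < r i)
    (hG : ∀ (z : ι → ℂ) (_ : ∀ i, ‖z i‖ ≤ r i) (i : ι) (w : ℂ), ‖w‖ ≤ r i →
      DifferentiableAt ℂ (fun w => G (Function.update z i w)) w)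
    {C : ℝ} (hC : ∀ z : ι → ℂ, (∀ i, ‖z i‖ = r i) → ‖G z‖ ≤ C)
    {z : ι → ℂ} (hz : ∀ i, ‖z i‖ ≤ r i) : ‖G z‖ ≤ C := by
  -- `S` collects the coordinates allowed inside their discs; each induction step frees one more by
  -- the one-variable maximum principle.
  have key : ∀ (S : Finset ι) (z : ι → ℂ), (∀ i, ‖z i‖ ≤ r i) → (∀ i ∉ S, ‖z i‖ = r i) →
      ‖G z‖ ≤ C := by
    intro S
    induction S using Finset.induction_on with
    | empty => exact fun z _ h => hC z fun i => h i (by simp)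
    | insert j S hj ih =>
      intro z hz hzS
      have hupd : ∀ w, ‖w‖ ≤ r j → ∀ i, ‖Function.update z j w i‖ ≤ r i := fun w hw i => by
        by_cases hij : i = j
        · subst hij; simpa using hw
        · simpa [hij] using hz i
      have hcl : closure (Metric.ball (0 : ℂ) (r j)) = Metric.closedBall 0 (r j) :=
        closure_ball _ (hr j).ne'
      have hdiff : DiffContOnCl ℂ (fun w => G (Function.update z j w)) (Metric.ball 0 (r j)) := by
        refine DifferentiableOn.diffContOnCl fun w hw => ?_
        rw [hcl, mem_closedBall_zero_iff] at hw
        exact (hG z hz j w hw).differentiableWithinAt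
      have hmax := Complex.norm_le_of_forall_mem_frontier_norm_le Metric.isBounded_ball hdiff
        (C := C) (fun w hw => by
          rw [frontier_ball _ (hr j).ne', mem_sphere_zero_iff_norm] at hw
          refine ih _ (hupd w hw.le) fun i hi => ?_
          by_cases hij : i = j
          · subst hij; simpa using hw
          · simpa [hij] using hzS i (by simp [hij, hi]))
        (z := z j) (by rw [hcl, mem_closedBall_zero_iff]; exact hz j)
      simpa using hmax
  exact key Finset.univ z hz fun i hi => absurd (Finset.mem_univ i) hi

/-- If a continuous separately holomorphic function is bounded below in modulus by `c > 0` on all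
tori `|zᵢ| = ρ ^ exponent i` with `0 < ρ ≤ 1`, then the bound holds on the whole unit polydisc. -/
theorem le_norm_of_forall_mem_torus_le_norm {ι : Type*} [Fintype ι] [DecidableEq ι] {P : (ι → ℂ) → ℂ}
    (hcont : Continuous P)
    (hdiff : ∀ z : ι → ℂ, ∀ i, Differentiable ℂ fun w => P (Function.update z i w))
    {exponent : ι → ℝ} (hexp : ∀ i, 0 < exponent i) {c : ℝ} (hc : 0 < c)
    (htorus : ∀ ρ : ℝ, 0 < ρ → ρ ≤ 1 → ∀ z : ι → ℂ, (∀ i, ‖z i‖ = ρ ^ exponent i) → c ≤ ‖P z‖)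
    {z : ι → ℂ} (hz : ∀ i, ‖z i‖ ≤ 1) : c ≤ ‖P z‖ := by
  set scale : ℝ × (ι → ℂ) → ι → ℂ := fun x i => ((x.1 ^ exponent i : ℝ) : ℂ) * x.2 i with hscale
  have hscont : Continuous scale := by
    refine continuous_pi fun i => ?_
    exact (Complex.continuous_ofReal.comp
      ((Real.continuous_rpow_const (hexp i).le).comp continuous_fst)).mul
      ((continuous_apply i).comp continuous_snd)
  have hPs : Continuous fun x => ‖P (scale x)‖ := (hcont.comp hscont).norm
  set D : Set (ι → ℂ) := {w | ∀ i, ‖w i‖ ≤ 1} with hD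
  have hDc : IsCompact D := by
    have : D = Set.univ.pi fun _ => Metric.closedBall (0 : ℂ) 1 := by
      ext w; simp [hD]
    rw [this]
    exact isCompact_univ_pi fun _ => isCompact_closedBall _ _
  -- Continuous induction on `ρ`: `A` is closed, contains 0, and extends to the right of each of its
  -- points below 1. The torus `ρ = 1` alone would not suffice, since `P` could vanish inside.
  set A : Set ℝ := {ρ | ∀ w ∈ D, c ≤ ‖P (scale (ρ, w))‖} with hA
  have hAc : IsClosed A := by
    simp only [hA, Set.ofPred_forall]
    exact isClosed_iInter fun w => isClosed_iInter fun _ =>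
      isClosed_le continuous_const (hPs.comp (Continuous.prodMk_left w))
  -- Once `P` has no zero on the polydisc, the maximum principle for `1/P` upgrades this to the
  -- bound `c`.
  have hpolydisc : ∀ ρ : ℝ, 0 < ρ → ρ ≤ 1 → (∀ w ∈ D, P (scale (ρ, w)) ≠ 0) → ρ ∈ A := by
    intro ρ hρ hρ1 hne w hw
    have hr : ∀ i, 0 < ρ ^ exponent i := fun i => Real.rpow_pos_of_pos hρ _
    have hne' : ∀ z : ι → ℂ, (∀ i, ‖z i‖ ≤ ρ ^ exponent i) → P z ≠ 0 := fun z hz => by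
      have h1 := hne (fun i => z i / ((ρ ^ exponent i : ℝ) : ℂ)) fun i => by
        rw [norm_div, Complex.norm_real, Real.norm_of_nonneg (hr i).le]
        exact (div_le_one (hr i)).2 (hz i)
      have h2 : scale (ρ, fun i => z i / ((ρ ^ exponent i : ℝ) : ℂ)) = z := by
        funext i
        exact mul_div_cancel₀ _ (Complex.ofReal_ne_zero.2 (hr i).ne')
      rwa [h2] at h1
    have hmem : ∀ i, ‖scale (ρ, w) i‖ ≤ ρ ^ exponent i := fun i => by
      simp only [hscale, norm_mul, Complex.norm_real, Real.norm_of_nonneg (hr i).le]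
      exact mul_le_of_le_one_right (hr i).le (hw i)
    have hbound := norm_le_of_forall_mem_torus_norm_le (G := fun z => (P z)⁻¹) hr
      (fun z hz i w hw => by
        refine DifferentiableAt.fun_inv ?_ (hne' _ fun j => ?_)
        · exact hdiff z i w
        · by_cases hji : j = i
          · subst hji; simpa using hw
          · simpa [hji] using hz j)
      (C := c⁻¹) (fun z hz => by
        rw [norm_inv]
        exact inv_anti₀ hc (htorus ρ hρ hρ1 z hz)) hmem
    rw [norm_inv] at hbound
    exact (inv_le_inv₀ (norm_pos_iff.2 (hne' _ hmem)) hc).1 hbound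
  -- At `ρ = 0` the polydisc shrinks to the origin, a limit of points on the tori.
  have hzero : (0 : ℝ) ∈ A := by
    intro w _
    have h0 : scale (0, w) = scale (0, fun _ => 1) := by
      funext i
      simp [hscale, Real.zero_rpow (hexp i).ne']
    rw [h0]
    have hlim : Filter.Tendsto (fun ρ : ℝ => ‖P (scale (ρ, fun _ => 1))‖)
        (nhdsWithin 0 (Set.Ioi 0)) (nhds ‖P (scale (0, fun _ => 1))‖) :=
      ((hPs.comp (Continuous.prodMk_left _)).tendsto 0).mono_left nhdsWithin_le_nhds
    refine ge_of_tendsto hlim ?_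
    filter_upwards [Ioc_mem_nhdsGT (zero_lt_one (α := ℝ))] with ρ hρ
    refine htorus ρ hρ.1 hρ.2 _ fun i => ?_
    simp [hscale, abs_of_pos (Real.rpow_pos_of_pos hρ.1 _)]
  have hall : Set.Icc (0 : ℝ) 1 ⊆ A := by
    refine IsClosed.Icc_subset_of_forall_exists_gt (hAc.inter isClosed_Icc) hzero ?_
    rintro ρ ⟨hρA, hρ0, hρ1⟩ y hy
    -- Compactness of `D` makes nonvanishing at radius `ρ` persist uniformly for nearby `σ`.
    have hev : ∀ᶠ σ in nhds ρ, ∀ w ∈ D, P (scale (σ, w)) ≠ 0 := by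
      refine hDc.eventually_forall_of_forall_eventually fun w hw => ?_
      have hpos : 0 < ‖P (scale (ρ, w))‖ := hc.trans_le (hρA w hw)
      filter_upwards [hPs.continuousAt.eventually (lt_mem_nhds hpos)] with x hx
      exact norm_pos_iff.1 hx
    have hev' : ∀ᶠ σ in nhdsWithin ρ (Set.Ioi ρ), ∀ w ∈ D, P (scale (σ, w)) ≠ 0 :=
      hev.filter_mono nhdsWithin_le_nhds
    obtain ⟨σ, hσ, hσm⟩ := (hev'.and (Ioc_mem_nhdsGT (lt_min hy hρ1))).exists
    exact ⟨σ, hpolydisc σ (hρ0.trans_lt hσm.1) (hσm.2.trans (min_le_right _ _)) hσ,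
      hσm.1, hσm.2.trans (min_le_left _ _)⟩
  have h1 := hall (Set.right_mem_Icc.2 zero_le_one) z hz
  simpa [hscale] using h1

/-! ### Dirichlet convolution on summable coefficients -/

namespace DirichletTwo

theorem mem_toFinset_factorPairs {k : ℕ+ × ℕ+} {p : (ℕ+ × ℕ+) × (ℕ+ × ℕ+)} :
    p ∈ (factorPairs_finite k).toFinset ↔ p.1 * p.2 = k := by
  simp [factorPairs]

/-- The fibres of multiplication are the sets of factor pairs, so this is regrouping a sum by
fibres. -/
theorem hasSum_sum_factorPairs {E : Type*} [NormedAddCommGroup E] [CompleteSpace E]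
    {F : (ℕ+ × ℕ+) × (ℕ+ × ℕ+) → E} {S : E} (h : HasSum F S) :
    HasSum (fun k => ∑ p ∈ (factorPairs_finite k).toFinset, F p) S := by
  convert! h.tsum_fiberwise (fun p => p.1 * p.2) using 2 with k
  rw [← Finset.tsum_subtype' (factorPairs_finite k).toFinset F, Set.Finite.coe_toFinset]
  rfl

theorem hasSum_conv {a b : ℕ+ × ℕ+ → ℂ} (ha : MemEllOne a) (hb : MemEllOne b) {A B : ℂ}
    (hA : HasSum a A) (hB : HasSum b B) : HasSum (conv a b) (A * B) :=
  hasSum_sum_factorPairs (hA.mul hB (summable_mul_of_summable_norm ha hb))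

/-- Provides both the stability of `ℓ¹` under convolution and the submultiplicativity of its norm.
-/
theorem hasSum_norm_mul_norm {a b : ℕ+ × ℕ+ → ℂ} (ha : MemEllOne a) (hb : MemEllOne b) :
    HasSum (fun k => ∑ p ∈ (factorPairs_finite k).toFinset, ‖a p.1‖ * ‖b p.2‖)
      ((∑' k, ‖a k‖) * ∑' k, ‖b k‖) := by
  refine hasSum_sum_factorPairs (F := fun p => ‖a p.1‖ * ‖b p.2‖)
    ((Summable.hasSum ha).mul (Summable.hasSum hb) ?_)
  exact Summable.mul_of_nonneg (f := fun k => ‖a k‖) (g := fun k => ‖b k‖) ha hb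
    (fun _ => norm_nonneg _) fun _ => norm_nonneg _

theorem norm_conv_le (a b : ℕ+ × ℕ+ → ℂ) (k : ℕ+ × ℕ+) :
    ‖conv a b k‖ ≤ ∑ p ∈ (factorPairs_finite k).toFinset, ‖a p.1‖ * ‖b p.2‖ :=
  (norm_sum_le _ _).trans_eq (Finset.sum_congr rfl fun _ _ => norm_mul _ _)

theorem MemEllOne.conv {a b : ℕ+ × ℕ+ → ℂ} (ha : MemEllOne a) (hb : MemEllOne b) :
    MemEllOne (conv a b) :=
  (hasSum_norm_mul_norm ha hb).summable.of_nonneg_of_le (fun _ => norm_nonneg _) (norm_conv_le a b)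

theorem conv_comm (a b : ℕ+ × ℕ+ → ℂ) : conv a b = conv b a := by
  funext k
  refine Finset.sum_nbij' Prod.swap Prod.swap ?_ ?_ (fun _ _ => rfl) (fun _ _ => rfl)
    fun p _ => mul_comm _ _
  all_goals
    intro p hp
    rw [mem_toFinset_factorPairs] at hp ⊢
    exact (mul_comm _ _).trans hp

theorem conv_assoc (a b c : ℕ+ × ℕ+ → ℂ) : conv (conv a b) c = conv a (conv b c) := by
  funext k
  simp only [conv, Finset.sum_mul, Finset.mul_sum, Finset.sum_sigma']
  refine Finset.sum_nbij'
    (fun x => ⟨(x.2.1, x.2.2 * x.1.2), (x.2.2, x.1.2)⟩)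
    (fun x => ⟨(x.1.1 * x.2.1, x.2.2), (x.1.1, x.2.1)⟩) ?_ ?_ ?_ ?_ ?_
  · rintro ⟨⟨x, w⟩, ⟨u, v⟩⟩ h
    simp only [Finset.mem_sigma, mem_toFinset_factorPairs] at h ⊢
    exact ⟨by rw [← h.1, ← h.2, mul_assoc], trivial⟩
  · rintro ⟨⟨u, y⟩, ⟨v, w⟩⟩ h
    simp only [Finset.mem_sigma, mem_toFinset_factorPairs] at h ⊢
    exact ⟨by rw [← h.1, ← h.2, mul_assoc], trivial⟩
  · rintro ⟨⟨x, w⟩, ⟨u, v⟩⟩ h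
    simp only [Finset.mem_sigma, mem_toFinset_factorPairs] at h
    obtain ⟨-, rfl⟩ := h
    rfl
  · rintro ⟨⟨u, y⟩, ⟨v, w⟩⟩ h
    simp only [Finset.mem_sigma, mem_toFinset_factorPairs] at h
    obtain ⟨-, rfl⟩ := h
    rfl
  · rintro ⟨⟨x, w⟩, ⟨u, v⟩⟩ _
    exact mul_assoc _ _ _

/-- Embeds the monoid `ℕ²` in the convolution algebra, so that algebra characters restrict to monoid
characters. -/
theorem conv_single_single (k l : ℕ+ × ℕ+) :
    conv (Pi.single k 1) (Pi.single l 1) = Pi.single (k * l) 1 := by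
  funext m
  have hne : ∀ p : (ℕ+ × ℕ+) × (ℕ+ × ℕ+), p ≠ (k, l) →
      (Pi.single k 1 : ℕ+ × ℕ+ → ℂ) p.1 * (Pi.single l 1 : ℕ+ × ℕ+ → ℂ) p.2 = 0 := by
    rintro ⟨u, v⟩ hp
    by_cases hu : u = k
    · have hv : v ≠ l := fun hv => hp (by rw [hu, hv])
      simp [hv]
    · simp [hu]
  by_cases hm : k * l = m
  · subst hm
    rw [conv, Finset.sum_eq_single_of_mem (k, l) (mem_toFinset_factorPairs.2 rfl)
      fun p _ hp => hne p hp]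
    simp
  · rw [conv, Finset.sum_eq_zero fun p hp => hne p ?_, Pi.single_eq_of_ne (Ne.symm hm)]
    rintro rfl
    exact hm (mem_toFinset_factorPairs.1 hp)

theorem convOne_conv (a : ℕ+ × ℕ+ → ℂ) : conv convOne a = a := by
  funext k
  rw [conv, Finset.sum_eq_single_of_mem (1, k) (mem_toFinset_factorPairs.2 (one_mul k))]
  · simp [convOne]
  · rintro ⟨u, v⟩ hp hne
    rw [mem_toFinset_factorPairs] at hp
    have hu : u ≠ 1 := by
      rintro rfl
      exact hne (by rw [← hp, one_mul])
    simp [convOne, hu]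

theorem conv_add (a b c : ℕ+ × ℕ+ → ℂ) : conv a (b + c) = conv a b + conv a c := by
  funext k
  simp only [conv, Pi.add_apply, mul_add, Finset.sum_add_distrib]

theorem conv_smul (r : ℂ) (a b : ℕ+ × ℕ+ → ℂ) : conv a (r • b) = r • conv a b := by
  funext k
  simp only [conv, Pi.smul_apply, smul_eq_mul, Finset.mul_sum]
  exact Finset.sum_congr rfl fun _ _ => by ring

/-! ### The Banach algebra `ℓ¹(ℕ²)` and its characters -/

/-- The Banach space `ℓ¹(ℕ²)`, to be equipped with Dirichlet convolution. -/
def EllOne : Type := lp (fun _ : ℕ+ × ℕ+ => ℂ) 1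

namespace EllOne

noncomputable instance : NormedAddCommGroup EllOne :=
  inferInstanceAs (NormedAddCommGroup (lp (fun _ : ℕ+ × ℕ+ => ℂ) 1))

noncomputable instance : NormedSpace ℂ EllOne :=
  inferInstanceAs (NormedSpace ℂ (lp (fun _ : ℕ+ × ℕ+ => ℂ) 1))

instance : CompleteSpace EllOne :=
  inferInstanceAs (CompleteSpace (lp (fun _ : ℕ+ × ℕ+ => ℂ) 1))

/-- The coefficients of an element of `ℓ¹(ℕ²)`. -/
def coeff (x : EllOne) : ℕ+ × ℕ+ → ℂ := x.1

theorem memEllOne_coeff (x : EllOne) : MemEllOne x.coeff := by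
  simpa [MemEllOne, coeff] using (lp.memℓp x).summable (by simp)

/-- The element of `ℓ¹(ℕ²)` with given coefficients. -/
def ofCoeff (a : ℕ+ × ℕ+ → ℂ) (ha : MemEllOne a) : EllOne :=
  ⟨a, memℓp_gen (by simpa [MemEllOne] using ha)⟩

@[simp]
theorem coeff_ofCoeff (a : ℕ+ × ℕ+ → ℂ) (ha : MemEllOne a) : (ofCoeff a ha).coeff = a := rfl

theorem coeff_injective : Function.Injective coeff := Subtype.val_injective

theorem norm_eq_tsum (x : EllOne) : ‖x‖ = ∑' k, ‖x.coeff k‖ := by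
  refine (lp.norm_eq_tsum_rpow (p := 1) (by simp) x).trans ?_
  simp only [ENNReal.toReal_one, Real.rpow_one, div_one]
  rfl

theorem memEllOne_single (k : ℕ+ × ℕ+) : MemEllOne (Pi.single k 1) :=
  summable_of_ne_finset_zero (s := {k}) fun l hl => by
    simp [Pi.single_eq_of_ne (Finset.notMem_singleton.1 hl)]

noncomputable instance : Mul EllOne :=
  ⟨fun x y => ofCoeff (conv x.coeff y.coeff) (x.memEllOne_coeff.conv y.memEllOne_coeff)⟩

noncomputable instance : One EllOne := ⟨ofCoeff convOne (memEllOne_single 1)⟩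

protected theorem mul_comm (x y : EllOne) : x * y = y * x := coeff_injective (conv_comm _ _)

protected theorem one_mul (x : EllOne) : 1 * x = x := coeff_injective (convOne_conv _)

protected theorem mul_add (x y z : EllOne) : x * (y + z) = x * y + x * z :=
  coeff_injective (conv_add _ _ _)

protected theorem mul_smul (r : ℂ) (x y : EllOne) : x * (r • y) = r • (x * y) :=
  coeff_injective (conv_smul _ _ _)

protected theorem mul_zero (x : EllOne) : x * 0 = 0 := by
  simpa using EllOne.mul_smul 0 x 0

noncomputable instance : NormedCommRing EllOne where
  __ := (inferInstance : NormedAddCommGroup EllOne)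
  mul_assoc x y z := coeff_injective (conv_assoc _ _ _)
  mul_comm := EllOne.mul_comm
  one_mul := EllOne.one_mul
  mul_one x := (EllOne.mul_comm x 1).trans (EllOne.one_mul x)
  left_distrib := EllOne.mul_add
  right_distrib x y z := by
    rw [EllOne.mul_comm, EllOne.mul_add, EllOne.mul_comm z x, EllOne.mul_comm z y]
  zero_mul x := (EllOne.mul_comm 0 x).trans (EllOne.mul_zero x)
  mul_zero := EllOne.mul_zero
  norm_mul_le x y := by
    have h := hasSum_norm_mul_norm x.memEllOne_coeff y.memEllOne_coeff
    rw [norm_eq_tsum, norm_eq_tsum x, norm_eq_tsum y, ← h.tsum_eq]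
    exact (x * y).memEllOne_coeff.tsum_le_tsum (norm_conv_le _ _) h.summable

noncomputable instance : NormedAlgebra ℂ EllOne where
  __ := Algebra.ofModule
    (fun r x y => by rw [mul_comm, EllOne.mul_smul, mul_comm])
    (fun r x y => EllOne.mul_smul r x y)
  norm_smul_le r x := norm_smul_le r x

/-- The unit mass at `k`. -/
noncomputable def basis (k : ℕ+ × ℕ+) : EllOne := ofCoeff (Pi.single k 1) (memEllOne_single k)

theorem norm_basis (k : ℕ+ × ℕ+) : ‖basis k‖ = 1 := by
  rw [norm_eq_tsum, tsum_eq_single k]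
  · simp [basis]
  · intro l hl
    simp [basis, hl]

/-- Lets a continuous character be computed from its values on unit masses. -/
theorem hasSum_smul_basis (x : EllOne) : HasSum (fun k => x.coeff k • basis k) x := by
  have h : @HasSum EllOne _ _ _ (fun k => lp.single 1 k (x.coeff k)) x _ :=
    lp.hasSum_single (p := 1) (by simp) x
  refine h.congr_fun fun k => ?_
  refine coeff_injective ?_
  funext l
  change x.coeff k * (Pi.single k 1 : ℕ+ × ℕ+ → ℂ) l =
    lp.single (E := fun _ : ℕ+ × ℕ+ => ℂ) 1 k (x.coeff k) l
  rw [lp.single_apply]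
  by_cases hl : l = k
  · subst hl
    simp
  · simp [hl]

end EllOne

/-- If `a ∈ ℓ¹(ℕ²)` has no inverse, then `∑ a(k) χ(k) = 0` for some bounded character `χ` of the
monoid `ℕ²`. -/
theorem exists_character_of_not_hasInverseInEllOne {a : ℕ+ × ℕ+ → ℂ} (ha : MemEllOne a)
    (hinv : ¬ HasInverseInEllOne a) :
    ∃ χ : ℕ+ × ℕ+ →* ℂ, (∀ k, ‖χ k‖ ≤ 1) ∧ HasSum (fun k => a k * χ k) 0 := by
  have hunit : ¬ IsUnit (EllOne.ofCoeff a ha) := by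
    intro h
    obtain ⟨y, hy⟩ := h.exists_right_inv
    have hy' : conv a y.coeff = convOne := congrArg EllOne.coeff hy
    exact hinv ⟨ha, y.coeff, y.memEllOne_coeff, hy', (conv_comm _ _).trans hy'⟩
  -- Gelfand theory: a non-unit of a commutative complex Banach algebra lies in the kernel of a
  -- character.
  obtain ⟨φ, hφ⟩ := WeakDual.CharacterSpace.exists_apply_eq_zero hunit
  have hone : ‖(1 : EllOne)‖ = 1 := EllOne.norm_basis 1
  refine ⟨⟨⟨fun k => φ (EllOne.basis k), map_one φ⟩, fun k l => ?_⟩, fun k => ?_, ?_⟩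
  · rw [← map_mul]
    exact congrArg φ (EllOne.coeff_injective (conv_single_single k l).symm)
  · have := AlgHom.norm_apply_le_self_mul_norm_one
      (WeakDual.CharacterSpace.toAlgHom φ) (EllOne.basis k)
    rwa [EllOne.norm_basis, hone, mul_one] at this
  · have h := ((EllOne.ofCoeff a ha).hasSum_smul_basis).mapL
      (WeakDual.CharacterSpace.toCLM φ)
    rw [show WeakDual.CharacterSpace.toCLM φ (EllOne.ofCoeff a ha) = 0 from hφ] at h
    convert! h using 2 with k
    exact (map_smul φ (a k) (EllOne.basis k)).symm

end DirichletTwo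

/-! ### From half planes to polydiscs through the primes -/

namespace DirichletTwo

/-- The point of the polydisc with coordinates `p ^ (-s₁)` and `p ^ (-s₂)`, for `p` in a finite set
of primes. -/
noncomputable def primePowerPoint (T : Finset Nat.Primes) (s₁ s₂ : ℂ) : T ⊕ T → ℂ :=
  Sum.elim (fun p => (((p : Nat.Primes) : ℕ) : ℂ) ^ (-s₁))
    (fun p => (((p : Nat.Primes) : ℕ) : ℂ) ^ (-s₂))

/-- A lower bound at the points `(p ^ (-s₁), p ^ (-s₂))` for `s₁`, `s₂` in the half plane extends to
the tori `|zₚ| = ρ ^ log p`. -/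
theorem le_norm_on_torus_of_le_norm_primePowerPoint (T : Finset Nat.Primes)
    {P : (T ⊕ T → ℂ) → ℂ} (hP : Continuous P) {c : ℝ}
    (h : ∀ s₁ s₂ : ℂ, 0 ≤ s₁.re → 0 ≤ s₂.re → c ≤ ‖P (primePowerPoint T s₁ s₂)‖)
    {ρ : ℝ} (hρ : 0 < ρ) (hρ1 : ρ ≤ 1) (z : T ⊕ T → ℂ)
    (hz : ∀ i, ‖z i‖ = ρ ^ Sum.elim (fun p : T => Real.log ((p : Nat.Primes) : ℕ))
      (fun p : T => Real.log ((p : Nat.Primes) : ℕ)) i) :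
    c ≤ ‖P z‖ := by
  set lg : T → ℝ := fun p => Real.log ((p : Nat.Primes) : ℕ) with hlg
  set Z : UnitAddTorus T × UnitAddTorus T → T ⊕ T → ℂ := fun x =>
    Sum.elim (fun p => ((ρ ^ lg p : ℝ) : ℂ) * (AddCircle.toCircle (x.1 p) : ℂ))
      (fun p => ((ρ ^ lg p : ℝ) : ℂ) * (AddCircle.toCircle (x.2 p) : ℂ))
  have hcirc : Continuous fun y : UnitAddCircle => (AddCircle.toCircle y : ℂ) :=
    continuous_subtype_val.comp AddCircle.continuous_toCircle
  have hZc : Continuous Z := by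
    refine continuous_pi fun i => ?_
    rcases i with p | p
    · exact continuous_const.mul (hcirc.comp ((continuous_apply p).comp continuous_fst))
    · exact continuous_const.mul (hcirc.comp ((continuous_apply p).comp continuous_snd))
  have hdense := UnitAddTorus.denseRange_linearFlow (ω := lg)
    (eq_zero_of_sum_int_mul_log_prime_eq_zero T)
  -- With `s = -log ρ - 2πit`, `p^(-s)` has modulus `ρ^(log p)` and phase `2πt log p`; `ρ ≤ 1` puts
  -- `s` in the half plane.
  have hcoord : ∀ (t : ℝ) (p : T),
      ((ρ ^ lg p : ℝ) : ℂ) * (AddCircle.toCircle (UnitAddTorus.linearFlow lg t p) : ℂ) =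
        (((p : Nat.Primes) : ℕ) : ℂ) ^
          (-((-Real.log ρ : ℝ) - (2 * Real.pi * t : ℝ) * Complex.I : ℂ)) := by
    intro t p
    have hp : (((p : Nat.Primes) : ℕ) : ℂ) ≠ 0 := by exact_mod_cast p.1.2.ne_zero
    rw [UnitAddTorus.linearFlow, AddCircle.toCircle_apply_mk, Circle.coe_exp,
      Complex.cpow_def_of_ne_zero hp, Real.rpow_def_of_pos hρ, Complex.ofReal_exp,
      ← Complex.exp_add, ← Complex.natCast_log]
    congr 1
    simp only [hlg]
    push_cast
    ring
  have hall : ∀ x, c ≤ ‖P (Z x)‖ := by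
    have hclosed : IsClosed {x | c ≤ ‖P (Z x)‖} :=
      isClosed_le continuous_const (hP.comp hZc).norm
    -- The variables `s₁` and `s₂` move independently, so a product of two dense flows covers both
    -- copies of the primes.
    refine isClosed_property (hdense.prodMap hdense) hclosed ?_
    rintro ⟨t₁, t₂⟩
    have hre : ∀ t : ℝ, 0 ≤ ((-Real.log ρ : ℝ) - (2 * Real.pi * t : ℝ) * Complex.I : ℂ).re := by
      intro t
      simpa using Real.log_nonpos hρ.le hρ1
    convert! h _ _ (hre t₁) (hre t₂) using 3
    funext i
    rcases i with p | p
    · exact hcoord t₁ p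
    · exact hcoord t₂ p
  have hpolar : ∀ i, ((‖z i‖ : ℝ) : ℂ) *
      (AddCircle.toCircle ((Complex.arg (z i) / (2 * Real.pi) : ℝ) : UnitAddCircle) : ℂ) = z i := by
    intro i
    rw [AddCircle.toCircle_apply_mk, Circle.coe_exp]
    conv_rhs => rw [← Complex.norm_mul_exp_arg_mul_I (z i)]
    congr 3
    push_cast
    field_simp
  convert! hall (fun p => ((Complex.arg (z (Sum.inl p)) / (2 * Real.pi) : ℝ) : UnitAddCircle),
    fun p => ((Complex.arg (z (Sum.inr p)) / (2 * Real.pi) : ℝ) : UnitAddCircle)) using 3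
  funext i
  rw [← hpolar i, hz i]
  rcases i with p | p <;> rfl

/-- A positive integer is the product of its prime powers over any finite set of primes containing
its prime factors. -/
theorem eq_prod_primes_pow_factorization (T : Finset Nat.Primes) (n : ℕ+)
    (hT : ∀ p : Nat.Primes, (p : ℕ) ∣ n → p ∈ T) :
    n = ∏ p : T, ((p : Nat.Primes) : ℕ+) ^ (n : ℕ).factorization ((p : Nat.Primes) : ℕ) := by
  refine PNat.coe_injective ?_
  have hcoe : ((∏ p : T, ((p : Nat.Primes) : ℕ+) ^
      (n : ℕ).factorization ((p : Nat.Primes) : ℕ) : ℕ+) : ℕ) =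
      ∏ p ∈ T, (p : ℕ) ^ (n : ℕ).factorization p := by
    rw [← Finset.prod_coe_sort T fun p : Nat.Primes => (p : ℕ) ^ (n : ℕ).factorization p]
    push_cast
    rfl
  rw [hcoe]
  refine Eq.trans ?_ (Finset.prod_map T ⟨((↑) : Nat.Primes → ℕ), Subtype.val_injective⟩
    fun p => p ^ (n : ℕ).factorization p)
  conv_lhs => rw [← Nat.prod_factorization_pow_eq_self n.ne_zero]
  refine Finset.prod_subset (fun p hp => ?_) fun p _ hp => ?_
  · have hp' := Nat.mem_primeFactors.1 (Nat.support_factorization n ▸ hp)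
    exact Finset.mem_map.2 ⟨⟨p, hp'.1⟩, hT ⟨p, hp'.1⟩ hp'.2.1, rfl⟩
  · rw [Finsupp.notMem_support_iff.1 hp]
    exact pow_zero p

/-- The monomial in variables indexed by two copies of a finite set of primes attached to a pair of
positive integers. -/
noncomputable def primeMonomial (T : Finset Nat.Primes) (k : ℕ+ × ℕ+) (z : T ⊕ T → ℂ) : ℂ :=
  (∏ p : T, z (Sum.inl p) ^ (k.1 : ℕ).factorization ((p : Nat.Primes) : ℕ)) *
    ∏ p : T, z (Sum.inr p) ^ (k.2 : ℕ).factorization ((p : Nat.Primes) : ℕ)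

theorem differentiable_primeMonomial (T : Finset Nat.Primes) (k : ℕ+ × ℕ+) :
    Differentiable ℂ (primeMonomial T k) := by
  unfold primeMonomial
  fun_prop

/-- Unique factorization: a character is determined by its values at the primes in each component.
-/
theorem character_eq_primeMonomial (T : Finset Nat.Primes) (χ : ℕ+ × ℕ+ →* ℂ) (k : ℕ+ × ℕ+)
    (hT : ∀ p : Nat.Primes, (p : ℕ) ∣ k.1 ∨ (p : ℕ) ∣ k.2 → p ∈ T) :
    χ k = primeMonomial T k (Sum.elim (fun p : T => χ (((p : Nat.Primes) : ℕ+), 1))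
      fun p : T => χ (1, ((p : Nat.Primes) : ℕ+))) := by
  have h₁ := congrArg (χ.comp (MonoidHom.inl ℕ+ ℕ+))
    (eq_prod_primes_pow_factorization T k.1 fun p hp => hT p (Or.inl hp))
  have h₂ := congrArg (χ.comp (MonoidHom.inr ℕ+ ℕ+))
    (eq_prod_primes_pow_factorization T k.2 fun p hp => hT p (Or.inr hp))
  rw [map_prod] at h₁ h₂
  simp only [map_pow] at h₁ h₂
  have hk : χ k = χ.comp (MonoidHom.inl ℕ+ ℕ+) k.1 * χ.comp (MonoidHom.inr ℕ+ ℕ+) k.2 := by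
    simp only [MonoidHom.comp_apply, MonoidHom.inl_apply, MonoidHom.inr_apply, ← map_mul]
    congr 1
    ext <;> simp
  rw [hk, h₁, h₂]
  rfl

/-! ### Dirichlet series as sums over characters -/

/-- The character `(m, n) ↦ m ^ (-s₁) * n ^ (-s₂)` of the monoid `ℕ²`. -/
noncomputable def dirichletCharacter (s₁ s₂ : ℂ) : ℕ+ × ℕ+ →* ℂ where
  toFun k := (k.1 : ℂ) ^ (-s₁) * (k.2 : ℂ) ^ (-s₂)
  map_one' := by simp
  map_mul' k l := by
    simp only [Prod.fst_mul, Prod.snd_mul, PNat.mul_coe, Nat.cast_mul,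
      Complex.natCast_mul_natCast_cpow]
    ring

theorem dirichletCharacter_apply (s₁ s₂ : ℂ) (k : ℕ+ × ℕ+) :
    dirichletCharacter s₁ s₂ k = (k.1 : ℂ) ^ (-s₁) * (k.2 : ℂ) ^ (-s₂) := rfl

theorem norm_dirichletCharacter_le_one {s₁ s₂ : ℂ} (h₁ : 0 ≤ s₁.re) (h₂ : 0 ≤ s₂.re)
    (k : ℕ+ × ℕ+) : ‖dirichletCharacter s₁ s₂ k‖ ≤ 1 := by
  have hle : ∀ (n : ℕ+) (s : ℂ), 0 ≤ s.re → ‖(n : ℂ) ^ (-s)‖ ≤ 1 := by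
    intro n s hs
    rw [Complex.norm_natCast_cpow_of_pos n.pos]
    exact Real.rpow_le_one_of_one_le_of_nonpos (by exact_mod_cast n.pos) (by simpa using hs)
  rw [dirichletCharacter_apply, norm_mul]
  exact mul_le_one₀ (hle _ _ h₁) (norm_nonneg _) (hle _ _ h₂)

theorem IsAbsDirichletSeries.hasSum {f : HalfPlane × HalfPlane → ℂ} {a : ℕ+ × ℕ+ → ℂ}
    (hf : IsAbsDirichletSeries f a) (s : HalfPlane × HalfPlane) :
    HasSum (fun k => a k * dirichletCharacter s.1 s.2 k) (f s) := by
  simpa only [dirichletCharacter_apply, ← mul_assoc] using hf.2 s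

theorem norm_mul_character_le {a : ℕ+ × ℕ+ → ℂ} {χ : ℕ+ × ℕ+ →* ℂ} (hχ : ∀ k, ‖χ k‖ ≤ 1)
    (k : ℕ+ × ℕ+) : ‖a k * χ k‖ ≤ ‖a k‖ := by
  rw [norm_mul]
  exact mul_le_of_le_one_right (norm_nonneg _) (hχ k)

theorem MemEllOne.mul_character {a : ℕ+ × ℕ+ → ℂ} (ha : MemEllOne a) {χ : ℕ+ × ℕ+ →* ℂ}
    (hχ : ∀ k, ‖χ k‖ ≤ 1) : MemEllOne fun k => a k * χ k :=
  Summable.of_nonneg_of_le (fun _ => norm_nonneg _) (norm_mul_character_le hχ) ha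

/-- Complete multiplicativity of `χ` lets it factor out of each term; evaluation at `χ` is therefore
multiplicative. -/
theorem conv_mul_character (a b : ℕ+ × ℕ+ → ℂ) (χ : ℕ+ × ℕ+ →* ℂ) :
    conv (fun k => a k * χ k) (fun k => b k * χ k) = fun k => conv a b k * χ k := by
  funext k
  simp only [conv, Finset.sum_mul]
  refine Finset.sum_congr rfl fun p hp => ?_
  rw [← mem_toFinset_factorPairs.1 hp, map_mul]
  ring

theorem IsAbsDirichletSeries.norm_le {f : HalfPlane × HalfPlane → ℂ} {a : ℕ+ × ℕ+ → ℂ}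
    (hf : IsAbsDirichletSeries f a) (s : HalfPlane × HalfPlane) : ‖f s‖ ≤ ∑' k, ‖a k‖ :=
  (hf.hasSum s).norm_le_of_bounded (Summable.hasSum hf.1)
    (norm_mul_character_le (norm_dirichletCharacter_le_one s.1.2 s.2.2))

theorem BoundedAwayFromZero.of_reciprocal {f : HalfPlane × HalfPlane → ℂ}
    (h : ReciprocalHasAbsDirichletSeries f) : BoundedAwayFromZero f := by
  obtain ⟨hne, b, hb⟩ := h
  -- The `+ 1` gives positivity without showing `b ≠ 0`.
  have hC : 0 < (∑' k, ‖b k‖) + 1 := add_pos_of_nonneg_of_pos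
    (tsum_nonneg fun _ => norm_nonneg _) one_pos
  refine ⟨_, inv_pos.2 hC, fun s => ?_⟩
  have hle := hb.norm_le s
  rw [norm_div, norm_one, one_div] at hle
  exact inv_le_of_inv_le₀ (norm_pos_iff.2 (hne s)) (hle.trans (lt_add_one _).le)

theorem HasInverseInEllOne.reciprocal {f : HalfPlane × HalfPlane → ℂ} {a : ℕ+ × ℕ+ → ℂ}
    (hf : IsAbsDirichletSeries f a) (h : HasInverseInEllOne a) :
    ReciprocalHasAbsDirichletSeries f := by
  obtain ⟨ha, b, hb, hab, -⟩ := h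
  have key : ∀ s : HalfPlane × HalfPlane,
      ∃ g, HasSum (fun k => b k * dirichletCharacter s.1 s.2 k) g ∧ f s * g = 1 := by
    intro s
    have hχ := norm_dirichletCharacter_le_one s.1.2 s.2.2
    obtain ⟨g, hg⟩ := (hb.mul_character hχ).of_norm
    refine ⟨g, hg, ?_⟩
    have hprod := hasSum_conv (ha.mul_character hχ) (hb.mul_character hχ) (hf.hasSum s) hg
    rw [conv_mul_character, hab] at hprod
    refine hprod.unique ?_
    convert! hasSum_single (f := fun k => convOne k * dirichletCharacter s.1 s.2 k) 1
      fun k hk => ?_ using 1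
    · simp [convOne]
    · simp [convOne, hk]
  refine ⟨fun s h0 => ?_, b, hb, fun s => ?_⟩
  · obtain ⟨g, -, hg⟩ := key s
    simp [h0] at hg
  · obtain ⟨g, hsum, hg⟩ := key s
    have hgf : 1 / f s = g := by
      rw [one_div]
      exact inv_eq_of_mul_eq_one_right hg
    change HasSum _ (1 / f s)
    rw [hgf]
    simpa only [dirichletCharacter_apply, ← mul_assoc] using hsum

theorem norm_sub_sum_le_of_hasSum {ι E : Type*} [NormedAddCommGroup E] {F : ι → E} {g : ι → ℝ}
    {A : E} {B : ℝ} (hF : HasSum F A) (hg : HasSum g B) (hle : ∀ i, ‖F i‖ ≤ g i) (S : Finset ι) :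
    ‖A - ∑ i ∈ S, F i‖ ≤ B - ∑ i ∈ S, g i := by
  have h₁ := (Finset.hasSum_compl_iff (f := F) (a := A - ∑ i ∈ S, F i) S).2
    (by rwa [sub_add_cancel])
  have h₂ := (Finset.hasSum_compl_iff (f := g) (a := B - ∑ i ∈ S, g i) S).2
    (by rwa [sub_add_cancel])
  exact h₁.norm_le_of_bounded h₂ fun i => hle i

/-- If a Dirichlet series with coefficients `a` is bounded away from zero on `ℍ²`, then
`∑ a(k) χ(k) ≠ 0` for every bounded character `χ` of the monoid `ℕ²`. -/
theorem IsAbsDirichletSeries.not_hasSum_character_zero {f : HalfPlane × HalfPlane → ℂ}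
    {a : ℕ+ × ℕ+ → ℂ} (hf : IsAbsDirichletSeries f a) (h : BoundedAwayFromZero f)
    {χ : ℕ+ × ℕ+ →* ℂ} (hχ : ∀ k, ‖χ k‖ ≤ 1) : ¬ HasSum (fun k => a k * χ k) 0 := by
  intro hzero
  obtain ⟨c, hc, hfc⟩ := h
  have hnorm : HasSum (fun k => ‖a k‖) (∑' k, ‖a k‖) := Summable.hasSum hf.1
  -- The tail outside `S` has `ℓ¹` mass below `c / 2`, so one truncation serves all bounded
  -- characters, both those from `ℍ²` and `χ`.
  obtain ⟨S, hS⟩ := (hnorm.eventually (lt_mem_nhds (sub_lt_self _ (half_pos hc)))).exists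
  have htrunc : ∀ (ψ : ℕ+ × ℕ+ →* ℂ), (∀ k, ‖ψ k‖ ≤ 1) → ∀ A, HasSum (fun k => a k * ψ k) A →
      ‖A - ∑ k ∈ S, a k * ψ k‖ < c / 2 := by
    intro ψ hψ A hA
    exact (norm_sub_sum_le_of_hasSum hA hnorm (norm_mul_character_le hψ) S).trans_lt (by linarith)
  set T : Finset Nat.Primes :=
    (S.biUnion fun k => (k.1 : ℕ).primeFactors ∪ (k.2 : ℕ).primeFactors).subtype Nat.Prime
  have hmem : ∀ k ∈ S, ∀ p : Nat.Primes, (p : ℕ) ∣ k.1 ∨ (p : ℕ) ∣ k.2 → p ∈ T := by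
    intro k hk p hp
    refine Finset.mem_subtype.2 (Finset.mem_biUnion.2 ⟨k, hk, Finset.mem_union.2 ?_⟩)
    exact hp.imp (fun h => Nat.mem_primeFactors.2 ⟨p.2, h, k.1.ne_zero⟩)
      fun h => Nat.mem_primeFactors.2 ⟨p.2, h, k.2.ne_zero⟩
  set P : (T ⊕ T → ℂ) → ℂ := fun z => ∑ k ∈ S, a k * primeMonomial T k z
  have hPdiff : Differentiable ℂ P := by
    refine Differentiable.fun_sum fun k _ => ?_
    exact (differentiable_primeMonomial T k).const_mul (a k)
  have hPχ : ∀ ψ : ℕ+ × ℕ+ →* ℂ, ∑ k ∈ S, a k * ψ k =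
      P (Sum.elim (fun p : T => ψ (((p : Nat.Primes) : ℕ+), 1))
        fun p : T => ψ (1, ((p : Nat.Primes) : ℕ+))) := fun ψ =>
    Finset.sum_congr rfl fun k hk => by rw [character_eq_primeMonomial T ψ k (hmem k hk)]
  have hhalf : ∀ s₁ s₂ : ℂ, 0 ≤ s₁.re → 0 ≤ s₂.re → c / 2 ≤ ‖P (primePowerPoint T s₁ s₂)‖ := by
    intro s₁ s₂ h₁ h₂
    have hpoint : primePowerPoint T s₁ s₂ =
        Sum.elim (fun p : T => dirichletCharacter s₁ s₂ (((p : Nat.Primes) : ℕ+), 1))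
          fun p : T => dirichletCharacter s₁ s₂ (1, ((p : Nat.Primes) : ℕ+)) := by
      funext i
      rcases i with p | p <;> simp [primePowerPoint, dirichletCharacter_apply] <;> rfl
    rw [hpoint, ← hPχ]
    have hlt := htrunc _ (norm_dirichletCharacter_le_one h₁ h₂) _
      (hf.hasSum (⟨s₁, h₁⟩, ⟨s₂, h₂⟩))
    have hge := hfc (⟨s₁, h₁⟩, ⟨s₂, h₂⟩)
    have := norm_sub_norm_le (f (⟨s₁, h₁⟩, ⟨s₂, h₂⟩))
      (∑ k ∈ S, a k * dirichletCharacter s₁ s₂ k)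
    linarith
  have hlog : ∀ p : T, 0 < Real.log ((p : Nat.Primes) : ℕ) := fun p =>
    Real.log_pos (by exact_mod_cast p.1.2.one_lt)
  have hlower := le_norm_of_forall_mem_torus_le_norm hPdiff.continuous
    (fun z i w => (hPdiff _).comp w (hasFDerivAt_update z w).differentiableAt)
    (exponent := Sum.elim (fun p : T => Real.log ((p : Nat.Primes) : ℕ))
      (fun p : T => Real.log ((p : Nat.Primes) : ℕ)))
    (by rintro (p | p) <;> exact hlog p) (half_pos hc)
    (fun ρ hρ hρ1 z hz =>
      le_norm_on_torus_of_le_norm_primePowerPoint T hPdiff.continuous hhalf hρ hρ1 z hz)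
    (z := Sum.elim (fun p : T => χ (((p : Nat.Primes) : ℕ+), 1))
      fun p : T => χ (1, ((p : Nat.Primes) : ℕ+)))
    (by rintro (p | p) <;> exact hχ _)
  rw [← hPχ] at hlower
  -- Since the full sum at `χ` is 0, its truncation is smaller than `c / 2`, against `hlower`.
  have hupper := htrunc χ hχ 0 hzero
  rw [zero_sub, norm_neg] at hupper
  linarith

end DirichletTwo

theorem theoremA
    (f : DirichletTwo.HalfPlane × DirichletTwo.HalfPlane → ℂ) (a : ℕ+ × ℕ+ → ℂ)
    (hf : DirichletTwo.IsAbsDirichletSeries f a) :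
    List.TFAE
      [DirichletTwo.ReciprocalHasAbsDirichletSeries f,
       DirichletTwo.HasInverseInEllOne a,
       DirichletTwo.BoundedAwayFromZero f] := by
  tfae_have 1 → 3 := DirichletTwo.BoundedAwayFromZero.of_reciprocal
  tfae_have 2 → 1 := DirichletTwo.HasInverseInEllOne.reciprocal hf
  tfae_have 3 → 2 := by
    intro h
    by_contra hinv
    obtain ⟨χ, hχ, hzero⟩ :=
      DirichletTwo.exists_character_of_not_hasInverseInEllOne hf.1 hinv
    exact hf.not_hasSum_character_zero h hχ hzero
  tfae_finish
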